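/- Let $a, b \in M_2(\mathbb{C}) = \mathcal{B}(\mathbb{C}^2)$ be complex symmetric matrices ($a^t = a$, $b^t = b$), and let $T_{a,b} \colon \mathcal{B}(\mathbb{C}^2) \to \mathcal{B}(\mathbb{C}^2)$ be the operator $T_{a,b}(x) = axb + bxa$. Then $$\|T_{a,b}\|_{cb} = \|T_{a,b}\| = \inf_{x > 0} \left\| x\, a a^* + \tfrac{1}{x}\, b b^* \right\|.$$ Here $\mathcal{B}(\mathbb{C}^2)$ carries the operator norm induced by the Euclidean norm of $\mathbb{C}^2$, $a^*$ is the conjugate transpose of $a$, $\|T_{a,b}\|$ is the operator norm of $T_{a,b}$, the infimum is over real $x > 0$, and $\|T\|_{cb} = \sup_{n \ge 1} \|T_n\|$ is the completely bounded norm, where $T_n$ acts on $M_n(\mathcal{B}(\mathbb{C}^2)) = \mathcal{B}((\mathbb{C}^2)^n)$ by $T_n([x_{ij}]) = [T(x_{ij})]$. -/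

import Mathlib

open scoped Matrix Matrix.Norms.L2Operator ENNReal

/-- The operator `T_{a,b} : x ↦ a x b + b x a` on `M_m(ℂ) = B(ℂ^m)`. Throughout, matrices carry
the operator norm induced by the Euclidean norm (scope `Matrix.Norms.L2Operator`). -/
noncomputable def jordanElementary {m : Type*} [Fintype m] [DecidableEq m] (a b : Matrix m m ℂ) :
    Matrix m m ℂ →L[ℂ] Matrix m m ℂ :=
  LinearMap.toContinuousLinearMap
    { toFun := fun x => a * x * b + b * x * a
      map_add' := fun x y => by simp only [Matrix.mul_add, Matrix.add_mul]; abel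
      map_smul' := fun c x => by simp }

/-- The `n`-th amplification `T_n : M_n(B(ℂ^m)) → M_n(B(ℂ^m))`, `[x_ij] ↦ [T x_ij]`.
The space `M_n(B(ℂ^m)) = B((ℂ^m)^n)` is realised as the matrices indexed by `Fin n × m` with their
operator norm: `X` stands for the block matrix whose `(i, j)` block is
`x_ij = (X (i, k) (j, l))_{k, l}`. -/
noncomputable def amplification {m : Type*} [Fintype m] [DecidableEq m] (n : ℕ)
    (T : Matrix m m ℂ →L[ℂ] Matrix m m ℂ) :
    Matrix (Fin n × m) (Fin n × m) ℂ →L[ℂ] Matrix (Fin n × m) (Fin n × m) ℂ :=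
  LinearMap.toContinuousLinearMap
    { toFun := fun X => Matrix.of fun p q =>
        T (Matrix.of fun k l => X (p.1, k) (q.1, l)) p.2 q.2
      map_add' := fun X Y => by
        ext p q
        exact congrFun (congrFun (T.map_add (Matrix.of fun k l => X (p.1, k) (q.1, l))
          (Matrix.of fun k l => Y (p.1, k) (q.1, l))) p.2) q.2
      map_smul' := fun c X => by
        ext p q
        exact congrFun (congrFun (T.map_smul c (Matrix.of fun k l => X (p.1, k) (q.1, l))) p.2)
          q.2 }

/-- The completely bounded norm `‖T‖_cb = sup_n ‖T_n‖`, with values in `[0, ∞]`. (The index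
`n = 0` contributes `0`.) -/
noncomputable def cbNorm {m : Type*} [Fintype m] [DecidableEq m]
    (T : Matrix m m ℂ →L[ℂ] Matrix m m ℂ) : ℝ≥0∞ :=
  ⨆ n : ℕ, ENNReal.ofReal ‖amplification n T‖

/-! Upper bound: Cauchy–Schwarz and weighted AM–GM bound `⟨(AXB + BXA)η, ξ⟩` by `‖X‖` times the mean
of the form of `(A, B)` at `η` and that of `(A*, B*)` at `ξ`. For symmetric `a`, `b`, entrywise
conjugation identifies these forms on `ℂ^m`, so both are at most `‖x aa* + x⁻¹ bb*‖` on unit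
vectors. They add over blocks, so every amplification obeys the same bound.

Lower bound, for `a, b ≠ 0`: at a minimiser `x`, some top eigenvector `ξ` of `x aa* + x⁻¹ bb*` is
balanced, `‖b*ξ‖ = x‖a*ξ‖` (`exists_balanced_top_vector`). Balance gives the conjugates of `a*ξ`,
`b*ξ` the Gram matrix of `x⁻¹b*ξ`, `x a*ξ`, so an isometry `U` carries one pair to the other. Then
`T(U)` sends the conjugate of `ξ` to `(x aa* + x⁻¹ bb*)ξ`, and the bound is attained. -/

section Hilbert

open ContinuousLinearMap Filter Topology

variable {H : Type*} [NormedAddCommGroup H] [InnerProductSpace ℂ H]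

/-! ### Weighted forms and the upper bound -/

/-- The quadratic form `ξ ↦ x ‖A ξ‖² + x⁻¹ ‖B ξ‖²`. -/
noncomputable def weightedForm (A B : H →L[ℂ] H) (x : ℝ) (ξ : H) : ℝ :=
  x * ‖A ξ‖ ^ 2 + x⁻¹ * ‖B ξ‖ ^ 2

/-- AM–GM on each product, always with weight `x` on the `A`-factor, lets the four squares regroup
into one form at `η` and one at `ξ`. -/
theorem cross_le_weightedForm (A B A' B' : H →L[ℂ] H) {x : ℝ} (hx : 0 < x) (η ξ : H) :
    ‖B η‖ * ‖A' ξ‖ + ‖A η‖ * ‖B' ξ‖ ≤ (weightedForm A B x η + weightedForm A' B' x ξ) / 2 := by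
  have key : ∀ p q : ℝ, p * q ≤ (x * p ^ 2 + x⁻¹ * q ^ 2) / 2 := fun p q => by
    have h : x * p ^ 2 + x⁻¹ * q ^ 2 - 2 * (p * q) = x * (p - x⁻¹ * q) ^ 2 := by
      field_simp; ring
    have : 0 ≤ x * (p - x⁻¹ * q) ^ 2 := by positivity
    linarith
  have h1 := key ‖A' ξ‖ ‖B η‖
  have h2 := key ‖A η‖ ‖B' ξ‖
  unfold weightedForm
  linarith

variable [FiniteDimensional ℂ H]

/-- A bound on the two weighted forms bounds the Jordan elementary operator. -/
theorem norm_jordan_le_of_weightedForm_le (A B X : H →L[ℂ] H) {x c : ℝ} (hx : 0 < x)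
    (h : ∀ η, ‖η‖ = 1 → weightedForm A B x η ≤ c)
    (h' : ∀ ξ, ‖ξ‖ = 1 → weightedForm (adjoint A) (adjoint B) x ξ ≤ c) (hc : 0 ≤ c) :
    ‖A ∘L X ∘L B + B ∘L X ∘L A‖ ≤ c * ‖X‖ := by
  refine opNorm_le_of_re_inner_le (by positivity) fun η ξ hη hξ => ?_
  have e : inner ℂ ((A ∘L X ∘L B + B ∘L X ∘L A) η) ξ =
      inner ℂ (X (B η)) (adjoint A ξ) + inner ℂ (X (A η)) (adjoint B ξ) := by
    simp [adjoint_inner_right]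
  rw [e, map_add]
  have h1 := re_inner_le_norm (𝕜 := ℂ) (X (B η)) (adjoint A ξ)
  have h2 := re_inner_le_norm (𝕜 := ℂ) (X (A η)) (adjoint B ξ)
  have h3 := mul_le_mul_of_nonneg_right (X.le_opNorm (B η)) (norm_nonneg (adjoint A ξ))
  have h4 := mul_le_mul_of_nonneg_right (X.le_opNorm (A η)) (norm_nonneg (adjoint B ξ))
  have h5 := mul_le_mul_of_nonneg_left
    (cross_le_weightedForm A B (adjoint A) (adjoint B) hx η ξ) (norm_nonneg X)
  have h6 : (weightedForm A B x η + weightedForm (adjoint A) (adjoint B) x ξ) / 2 ≤ c := by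
    linarith [h η hη, h' ξ hξ]
  have h7 := mul_le_mul_of_nonneg_left h6 (norm_nonneg X)
  nlinarith

/-- The positive operator `x A* A + x⁻¹ B* B`. -/
noncomputable def weightedOp (A B : H →L[ℂ] H) (x : ℝ) : H →L[ℂ] H :=
  x • (adjoint A ∘L A) + x⁻¹ • (adjoint B ∘L B)

theorem inner_weightedOp (A B : H →L[ℂ] H) (x : ℝ) (η ξ : H) :
    inner ℂ (weightedOp A B x η) ξ =
      (x : ℂ) * inner ℂ (A η) (A ξ) + (x⁻¹ : ℝ) * inner ℂ (B η) (B ξ) := by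
  simp [weightedOp, adjoint_inner_left, ← Complex.coe_smul, mul_comm]

theorem re_inner_weightedOp_self (A B : H →L[ℂ] H) (x : ℝ) (ξ : H) :
    (inner ℂ (weightedOp A B x ξ) ξ).re = weightedForm A B x ξ := by
  rw [inner_weightedOp, Complex.add_re, Complex.re_ofReal_mul, Complex.re_ofReal_mul,
    ← RCLike.re_to_complex, ← RCLike.re_to_complex, inner_self_eq_norm_sq, inner_self_eq_norm_sq]
  rfl

theorem weightedForm_le (A B : H →L[ℂ] H) (x : ℝ) (ξ : H) :
    weightedForm A B x ξ ≤ ‖weightedOp A B x‖ * ‖ξ‖ ^ 2 := by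
  rw [← re_inner_weightedOp_self]
  have h1 := re_inner_le_norm (𝕜 := ℂ) (weightedOp A B x ξ) ξ
  have h2 := mul_le_mul_of_nonneg_right ((weightedOp A B x).le_opNorm ξ) (norm_nonneg ξ)
  simp only [RCLike.re_to_complex] at h1
  nlinarith

theorem norm_weightedOp_le (A B : H →L[ℂ] H) {x c : ℝ} (hx : 0 < x) (hc : 0 ≤ c)
    (h : ∀ η, ‖η‖ = 1 → weightedForm A B x η ≤ c) : ‖weightedOp A B x‖ ≤ c := by
  refine opNorm_le_of_re_inner_le hc fun η ξ hη hξ => ?_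
  have h1 := re_inner_le_norm (𝕜 := ℂ) (A η) (A ξ)
  have h2 := re_inner_le_norm (𝕜 := ℂ) (B η) (B ξ)
  have h3 : weightedForm A B x η + weightedForm A B x ξ ≤ 2 * c := by linarith [h η hη, h ξ hξ]
  rw [inner_weightedOp, RCLike.re_to_complex, Complex.add_re, Complex.re_ofReal_mul,
    Complex.re_ofReal_mul]
  simp only [RCLike.re_to_complex] at h1 h2
  have h4 : (inner ℂ (A η) (A ξ)).re ≤ (‖A η‖ ^ 2 + ‖A ξ‖ ^ 2) / 2 := by
    nlinarith [sq_nonneg (‖A η‖ - ‖A ξ‖)]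
  have h5 : (inner ℂ (B η) (B ξ)).re ≤ (‖B η‖ ^ 2 + ‖B ξ‖ ^ 2) / 2 := by
    nlinarith [sq_nonneg (‖B η‖ - ‖B ξ‖)]
  have h6 := mul_le_mul_of_nonneg_left h4 hx.le
  have h7 := mul_le_mul_of_nonneg_left h5 (inv_pos.2 hx).le
  unfold weightedForm at h3
  linarith

theorem exists_weightedForm_eq [Nontrivial H] (A B : H →L[ℂ] H) {x : ℝ} (hx : 0 < x) :
    ∃ ξ : H, ‖ξ‖ = 1 ∧ weightedForm A B x ξ = ‖weightedOp A B x‖ := by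
  have : ProperSpace H := FiniteDimensional.proper ℂ H
  let _ : NormedSpace ℝ H := NormedSpace.restrictScalars ℝ ℂ H
  have hne : (Metric.sphere (0 : H) 1).Nonempty := NormedSpace.sphere_nonempty.2 zero_le_one
  have hcont : Continuous (weightedForm A B x) := by unfold weightedForm; fun_prop
  obtain ⟨ξ, hξ, hmax⟩ := (isCompact_sphere (0 : H) 1).exists_isMaxOn hne hcont.continuousOn
  have hξ1 : ‖ξ‖ = 1 := by simpa using hξ
  refine ⟨ξ, hξ1, le_antisymm (by simpa [hξ1] using weightedForm_le A B x ξ) ?_⟩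
  refine norm_weightedOp_le A B hx (by unfold weightedForm; positivity) fun η hη => ?_
  exact hmax (by simpa using hη)

/-- Equality in Cauchy–Schwarz: with `S` the operator, `‖Sξ - ‖S‖ξ‖² = ‖Sξ‖² - ‖S‖²‖ξ‖² ≤ 0`. -/
theorem weightedOp_apply_of_weightedForm_eq (A B : H →L[ℂ] H) {x : ℝ} {ξ : H}
    (h : weightedForm A B x ξ = ‖weightedOp A B x‖ * ‖ξ‖ ^ 2) :
    weightedOp A B x ξ = ((‖weightedOp A B x‖ : ℝ) : ℂ) • ξ := by
  rw [← sub_eq_zero, ← norm_eq_zero, ← sq_eq_zero_iff]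
  refine le_antisymm ?_ (sq_nonneg _)
  rw [norm_sub_sq (𝕜 := ℂ), inner_smul_right, RCLike.re_to_complex, Complex.re_ofReal_mul,
    re_inner_weightedOp_self, h, norm_smul, Complex.norm_real, norm_norm]
  have h2 := (weightedOp A B x).le_opNorm ξ
  have h3 := pow_le_pow_left₀ (norm_nonneg _) h2 2
  nlinarith

/-! ### Minimising over the weight -/

theorem continuousOn_norm_weightedOp (A B : H →L[ℂ] H) :
    ContinuousOn (fun x : ℝ => ‖weightedOp A B x‖) (Set.Ioi 0) := by
  unfold weightedOp
  exact ((continuousOn_id.smul continuousOn_const).add ((continuousOn_id.inv₀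
    fun p hp => ne_of_gt hp).smul continuousOn_const)).norm

theorem exists_min_norm_weightedOp (A B : H →L[ℂ] H) (hA : A ≠ 0) (hB : B ≠ 0) :
    ∃ x₀ : ℝ, 0 < x₀ ∧ ∀ x, 0 < x → ‖weightedOp A B x₀‖ ≤ ‖weightedOp A B x‖ := by
  obtain ⟨ξ, hξ⟩ : ∃ ξ, A ξ ≠ 0 := by
    by_contra! h; exact hA (ContinuousLinearMap.ext h)
  obtain ⟨ζ, hζ⟩ : ∃ ζ, B ζ ≠ 0 := by
    by_contra! h; exact hB (ContinuousLinearMap.ext h)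
  have hξ0 : 0 < ‖ξ‖ := norm_pos_iff.2 fun h => hξ (by simp [h])
  have hζ0 : 0 < ‖ζ‖ := norm_pos_iff.2 fun h => hζ (by simp [h])
  have hp : 0 < ‖A ξ‖ ^ 2 / ‖ξ‖ ^ 2 := by have := norm_pos_iff.2 hξ; positivity
  have hq : 0 < ‖B ζ‖ ^ 2 / ‖ζ‖ ^ 2 := by have := norm_pos_iff.2 hζ; positivity
  set p := ‖A ξ‖ ^ 2 / ‖ξ‖ ^ 2
  set q := ‖B ζ‖ ^ 2 / ‖ζ‖ ^ 2
  set f : ℝ → ℝ := fun x => ‖weightedOp A B x‖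
  have h1 : ∀ x, 0 < x → x * p ≤ f x := fun x hx => by
    have h := weightedForm_le A B x ξ
    have h' : 0 ≤ x⁻¹ * ‖B ξ‖ ^ 2 := by positivity
    rw [← mul_div_assoc, div_le_iff₀ (by positivity)]
    unfold weightedForm at h
    linarith
  have h2 : ∀ x, 0 < x → q ≤ f x * x := fun x hx => by
    have h := weightedForm_le A B x ζ
    have h' : 0 ≤ x * ‖A ζ‖ ^ 2 := by positivity
    have h3 : x⁻¹ * ‖B ζ‖ ^ 2 ≤ f x * ‖ζ‖ ^ 2 := by
      unfold weightedForm at h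
      linarith
    rw [inv_mul_le_iff₀ hx] at h3
    rw [div_le_iff₀ (by positivity)]
    linarith
  have hf1 : 0 < f 1 := by have := h1 1 one_pos; linarith
  have hl : 0 < q / f 1 := by positivity
  -- Since `f x ≥ x p` and `f x ≥ q / x`, any `x` with `f x ≤ f 1` lies in this interval.
  have hmem : (1 : ℝ) ∈ Set.Icc (q / f 1) (f 1 / p) := by
    constructor
    · rw [div_le_one hf1]; simpa using h2 1 one_pos
    · rw [one_le_div hp]; simpa using h1 1 one_pos
  obtain ⟨x₀, hx₀, hmin⟩ := (isCompact_Icc (a := q / f 1) (b := f 1 / p)).exists_isMinOn ⟨1, hmem⟩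
    ((continuousOn_norm_weightedOp A B).mono fun x hx => lt_of_lt_of_le hl hx.1)
  have hle1 : f x₀ ≤ f 1 := hmin hmem
  refine ⟨x₀, lt_of_lt_of_le hl hx₀.1, fun x hx => ?_⟩
  change f x₀ ≤ f x
  by_contra! hlt
  have hlt1 : f x < f 1 := lt_of_lt_of_le hlt hle1
  refine absurd (hmin (a := x) ⟨?_, ?_⟩) (not_le.2 hlt)
  · rw [div_le_iff₀ hf1]; nlinarith [h2 x hx]
  · rw [le_div_iff₀ hp]; linarith [h1 x hx]

/-- First-order condition at a minimum, in the direction given by the sign of `σ`. -/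
theorem exists_top_vector_one_sided [Nontrivial H] (A B : H →L[ℂ] H) {x₀ : ℝ} (hx₀ : 0 < x₀)
    (hmin : ∀ x, 0 < x → ‖weightedOp A B x₀‖ ≤ ‖weightedOp A B x‖) {σ : ℝ} (hσ : |σ| ≤ 1)
    (hσ0 : σ ≠ 0) :
    ∃ ξ : H, ‖ξ‖ = 1 ∧ weightedForm A B x₀ ξ = ‖weightedOp A B x₀‖ ∧
      0 ≤ σ * (x₀ ^ 2 * ‖A ξ‖ ^ 2 - ‖B ξ‖ ^ 2) := by
  have : ProperSpace H := FiniteDimensional.proper ℂ H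
  -- Weights tending to `x₀` from the side of `σ`; the factor `2⁻¹` keeps them positive.
  set t : ℕ → ℝ := fun k => x₀ * (1 + σ * (1 / ((k : ℝ) + 1)) * 2⁻¹)
  have ht : Tendsto t atTop (𝓝 x₀) := by
    have := ((((tendsto_one_div_add_atTop_nhds_zero_nat (𝕜 := ℝ)).const_mul σ).mul_const
      2⁻¹).const_add 1).const_mul x₀
    simpa [t] using this
  have htpos : ∀ k, 0 < t k := fun k => by
    have h1 : (1 / ((k : ℝ) + 1)) ≤ 1 := by
      rw [div_le_one (by positivity)]; linarith [k.cast_nonneg (α := ℝ)]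
    have h0 : 0 ≤ (1 / ((k : ℝ) + 1)) := by positivity
    have h2 := abs_le.1 hσ
    have : -1 ≤ σ * (1 / ((k : ℝ) + 1)) := by nlinarith
    have : 0 < 1 + σ * (1 / ((k : ℝ) + 1)) * 2⁻¹ := by linarith
    exact mul_pos hx₀ this
  choose ξ hξ1 hξ using fun k => exists_weightedForm_eq A B (htpos k)
  have hsign : ∀ k, 0 ≤ σ * (x₀ * t k * ‖A (ξ k)‖ ^ 2 - ‖B (ξ k)‖ ^ 2) := fun k => by
    -- `ξ k` is a top vector at `t k`, where the norm is no smaller than at `x₀`.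
    have h1 : weightedForm A B x₀ (ξ k) ≤ weightedForm A B (t k) (ξ k) := by
      rw [hξ k]
      refine le_trans ?_ (hmin _ (htpos k))
      simpa [hξ1 k] using weightedForm_le A B x₀ (ξ k)
    have h2 : weightedForm A B (t k) (ξ k) - weightedForm A B x₀ (ξ k) =
        ((1 / ((k : ℝ) + 1)) * 2⁻¹ / t k) * (σ * (x₀ * t k * ‖A (ξ k)‖ ^ 2 - ‖B (ξ k)‖ ^ 2)) := by
      have hd : t k - x₀ = x₀ * σ * ((1 / ((k : ℝ) + 1)) * 2⁻¹) := by simp only [t]; ring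
      have e : weightedForm A B (t k) (ξ k) - weightedForm A B x₀ (ξ k) =
          (t k - x₀) * (x₀ * t k * ‖A (ξ k)‖ ^ 2 - ‖B (ξ k)‖ ^ 2) / (x₀ * t k) := by
        have := (htpos k).ne'
        unfold weightedForm; field_simp; ring
      rw [e, hd]
      have := (htpos k).ne'
      field_simp
    have h3 : 0 < (1 / ((k : ℝ) + 1)) * 2⁻¹ / t k := by have := htpos k; positivity
    exact nonneg_of_mul_nonneg_right (h2 ▸ sub_nonneg.2 h1) h3
  obtain ⟨ζ, hζ, φ, hφ, hlim⟩ := (isCompact_sphere (0 : H) 1).tendsto_subseq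
    (x := ξ) fun k => by simpa using hξ1 k
  have htφ := ht.comp hφ.tendsto_atTop
  have hAl : Tendsto (fun k => ‖A (ξ (φ k))‖ ^ 2) atTop (𝓝 (‖A ζ‖ ^ 2)) :=
    (((A.continuous.tendsto ζ).comp hlim).norm).pow 2
  have hBl : Tendsto (fun k => ‖B (ξ (φ k))‖ ^ 2) atTop (𝓝 (‖B ζ‖ ^ 2)) :=
    (((B.continuous.tendsto ζ).comp hlim).norm).pow 2
  refine ⟨ζ, by simpa using hζ, ?_, ?_⟩
  · have h1 : Tendsto (fun k => weightedForm A B (t (φ k)) (ξ (φ k))) atTop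
        (𝓝 (weightedForm A B x₀ ζ)) := (htφ.mul hAl).add ((htφ.inv₀ hx₀.ne').mul hBl)
    have h2 : Tendsto (fun k => ‖weightedOp A B (t (φ k))‖) atTop (𝓝 ‖weightedOp A B x₀‖) :=
      (((continuousOn_norm_weightedOp A B).continuousAt (Ioi_mem_nhds hx₀)).tendsto).comp htφ
    exact tendsto_nhds_unique h1 (h2.congr fun k => (hξ (φ k)).symm)
  · have h1 : Tendsto (fun k => σ * (x₀ * t (φ k) * ‖A (ξ (φ k))‖ ^ 2 - ‖B (ξ (φ k))‖ ^ 2)) atTop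
        (𝓝 (σ * (x₀ * x₀ * ‖A ζ‖ ^ 2 - ‖B ζ‖ ^ 2))) :=
      (((htφ.const_mul x₀).mul hAl).sub hBl).const_mul σ
    have := ge_of_tendsto' h1 fun k => hsign (φ k)
    rwa [← pow_two] at this

/-- At a minimum of `x ↦ ‖x A* A + x⁻¹ B* B‖` some top eigenvector balances the two terms. -/
theorem exists_balanced_top_vector [Nontrivial H] (A B : H →L[ℂ] H) {x₀ : ℝ} (hx₀ : 0 < x₀)
    (hmin : ∀ x, 0 < x → ‖weightedOp A B x₀‖ ≤ ‖weightedOp A B x‖) :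
    ∃ ξ : H, ξ ≠ 0 ∧ weightedOp A B x₀ ξ = ((‖weightedOp A B x₀‖ : ℝ) : ℂ) • ξ ∧
      ‖B ξ‖ = x₀ * ‖A ξ‖ := by
  obtain ⟨ξ, hξ1, hξ, hξs⟩ := exists_top_vector_one_sided A B hx₀ hmin (σ := 1) (by simp) (by simp)
  obtain ⟨ζ, hζ1, hζ, hζs⟩ := exists_top_vector_one_sided A B hx₀ hmin (σ := -1) (by simp) (by simp)
  have eξ := weightedOp_apply_of_weightedForm_eq A B (x := x₀) (ξ := ξ) (by simp [hξ, hξ1])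
  have eζ := weightedOp_apply_of_weightedForm_eq A B (x := x₀) (ξ := ζ) (by simp [hζ, hζ1])
  set h : H → ℝ := fun η => x₀ * ‖A η‖ - ‖B η‖ with hh
  have hξ0 : 0 ≤ h ξ := by
    have : ‖B ξ‖ ^ 2 ≤ (x₀ * ‖A ξ‖) ^ 2 := by nlinarith
    exact sub_nonneg.2 ((sq_le_sq₀ (norm_nonneg _) (by positivity)).1 this)
  have hζ0 : h ζ ≤ 0 := by
    have : (x₀ * ‖A ζ‖) ^ 2 ≤ ‖B ζ‖ ^ 2 := by nlinarith
    exact sub_nonpos.2 ((sq_le_sq₀ (by positivity) (norm_nonneg _)).1 this)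
  have hξne : ξ ≠ 0 := fun h => by simp [h] at hξ1
  have hsmul : ∀ (c : ℂ) η, h (c • η) = ‖c‖ * h η := fun c η => by
    simp only [hh, map_smul, norm_smul]; ring
  have done : ∀ η : H, η ≠ 0 → weightedOp A B x₀ η = ((‖weightedOp A B x₀‖ : ℝ) : ℂ) • η →
      h η = 0 → ∃ ξ : H, ξ ≠ 0 ∧ weightedOp A B x₀ ξ = ((‖weightedOp A B x₀‖ : ℝ) : ℂ) • ξ ∧
      ‖B ξ‖ = x₀ * ‖A ξ‖ := fun η h0 h1 h2 => ⟨η, h0, h1, (sub_eq_zero.1 h2).symm⟩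
  by_cases hdep : ∃ c : ℂ, ζ = c • ξ
  · obtain ⟨c, rfl⟩ := hdep
    have hc : ‖c‖ = 1 := by simpa [norm_smul, hξ1] using hζ1
    rw [hsmul, hc, one_mul] at hζ0
    exact done ξ hξne eξ (le_antisymm hζ0 hξ0)
  -- The segment from `ζ` to `ξ` stays in the top eigenspace and, by independence, avoids `0`; the
  -- balance defect `h` changes sign along it.
  · set γ : ℝ → H := fun s => ((s : ℝ) : ℂ) • ξ + ((1 - s : ℝ) : ℂ) • ζ
    have hγ : Continuous fun s => h (γ s) := by
      simp only [hh, γ]; fun_prop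
    have hivt := intermediate_value_Icc (zero_le_one (α := ℝ)) hγ.continuousOn
    obtain ⟨s, -, hs⟩ := hivt (show (0 : ℝ) ∈ _ from by simp [γ, hξ0, hζ0])
    refine done (γ s) (fun h0 => ?_) ?_ hs
    · by_cases h1 : (1 - s : ℝ) = 0
      · have : s = 1 := by linarith
        simp [γ, this, hξne] at h0
      · have h1' : ((1 - s : ℝ) : ℂ) ≠ 0 := by exact_mod_cast h1
        refine hdep ⟨-(((1 - s : ℝ) : ℂ)⁻¹ * s), ?_⟩
        have h2 : ((1 - s : ℝ) : ℂ) • ζ = -((s : ℂ) • ξ) := by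
          rw [eq_neg_iff_add_eq_zero, add_comm]; exact h0
        rw [neg_smul, mul_smul, ← smul_neg, ← h2, smul_smul, inv_mul_cancel₀ h1', one_smul]
    · simp only [γ, map_add, map_smul, eξ, eζ, smul_add]
      rw [smul_comm, smul_comm (((1 - s : ℝ) : ℂ))]

/-! ### Isometries from Gram data -/

/-- Linear maps with equal norms differ by an isometry of the target. -/
theorem exists_linearIsometry_comp_eq {W : Type*} [AddCommGroup W] [Module ℂ W] (P Q : W →ₗ[ℂ] H)
    (h : ∀ w, ‖P w‖ = ‖Q w‖) : ∃ U : H →ₗᵢ[ℂ] H, ∀ w, U (P w) = Q w := by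
  obtain ⟨s, hs⟩ := P.rangeRestrict.exists_rightInverse_of_surjective P.range_rangeRestrict
  have hs' : ∀ y : LinearMap.range P, P (s y) = y := fun y =>
    congrArg Subtype.val (LinearMap.congr_fun hs y)
  let L : LinearMap.range P →ₗᵢ[ℂ] H := ⟨Q ∘ₗ s, fun y => by
    rw [LinearMap.comp_apply, ← h, hs']; rfl⟩
  refine ⟨L.extend, fun w => ?_⟩
  have h1 : L.extend (P w) = L ⟨P w, w, rfl⟩ := L.extend_apply ⟨P w, w, rfl⟩
  rw [h1]
  change Q (s ⟨P w, w, rfl⟩) = Q w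
  -- Two preimages under `P` differ by an element of `ker P`, which `h` puts in `ker Q`.
  rw [← sub_eq_zero, ← map_sub, ← norm_eq_zero, ← h, map_sub, hs']
  simp

/-- Pairs of vectors with the same Gram matrix differ by an isometry. -/
theorem exists_linearIsometry_of_gram_eq {u v u' v' : H} (hu : ‖u‖ = ‖u'‖) (hv : ‖v‖ = ‖v'‖)
    (huv : inner ℂ u v = inner ℂ u' v') : ∃ U : H →ₗᵢ[ℂ] H, U u = u' ∧ U v = v' := by
  let P (u v : H) : ℂ × ℂ →ₗ[ℂ] H :=
    (LinearMap.toSpanSingleton ℂ H u).coprod (LinearMap.toSpanSingleton ℂ H v)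
  obtain ⟨U, hU⟩ := exists_linearIsometry_comp_eq (P u v) (P u' v') fun w => by
    rw [← sq_eq_sq₀ (norm_nonneg _) (norm_nonneg _)]
    simp only [P, LinearMap.coprod_apply, LinearMap.toSpanSingleton_apply]
    rw [norm_add_sq (𝕜 := ℂ), norm_add_sq (𝕜 := ℂ)]
    simp only [norm_smul, inner_smul_left, inner_smul_right, hu, hv, huv]
  exact ⟨U, by simpa [P] using hU (1, 0), by simpa [P] using hU (0, 1)⟩

end Hilbert

/-! ### Conjugation, amplifications and matrix norms -/

section MatrixPart

open ContinuousLinearMap Matrix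

/-- Entrywise complex conjugation on `ℂ^m`. -/
noncomputable def conjVec {m : Type*} (v : EuclideanSpace ℂ m) : EuclideanSpace ℂ m :=
  WithLp.toLp 2 (star (WithLp.ofLp v))

theorem conjVec_conjVec {m : Type*} (v : EuclideanSpace ℂ m) : conjVec (conjVec v) = v := by
  simp [conjVec]

variable {m : Type*} [Fintype m]

theorem norm_conjVec (v : EuclideanSpace ℂ m) : ‖conjVec v‖ = ‖v‖ := by
  simp [conjVec, EuclideanSpace.norm_eq]

theorem inner_conjVec (u v : EuclideanSpace ℂ m) :
    inner ℂ (conjVec u) (conjVec v) = inner ℂ v u := by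
  simp [conjVec, EuclideanSpace.inner_eq_star_dotProduct, dotProduct_comm]

/-- The `i`-th block of a vector in `(ℂ^m)^n`. -/
noncomputable def blockVec {n : ℕ} (η : EuclideanSpace ℂ (Fin n × m)) (i : Fin n) :
    EuclideanSpace ℂ m :=
  WithLp.toLp 2 fun k => η (i, k)

theorem norm_sq_eq_sum_blockVec {n : ℕ} (η : EuclideanSpace ℂ (Fin n × m)) :
    ‖η‖ ^ 2 = ∑ i, ‖blockVec η i‖ ^ 2 := by
  simp only [EuclideanSpace.norm_sq_eq, Fintype.sum_prod_type, blockVec]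

variable [DecidableEq m]

local notation "Φ" => Matrix.toEuclideanCLM (𝕜 := ℂ)

theorem toEuclideanCLM_conjTranspose (a : Matrix m m ℂ) : Φ aᴴ = adjoint (Φ a) :=
  map_star (Matrix.toEuclideanCLM (n := m) (𝕜 := ℂ)) a

theorem adjoint_toEuclideanCLM_conjTranspose (a : Matrix m m ℂ) : adjoint (Φ aᴴ) = Φ a := by
  rw [← toEuclideanCLM_conjTranspose, conjTranspose_conjTranspose]

theorem norm_weightedOp_conjTranspose (a b : Matrix m m ℂ) (x : ℝ) :
    ‖weightedOp (Φ aᴴ) (Φ bᴴ) x‖ = ‖x • (a * aᴴ) + (1 / x) • (b * bᴴ)‖ := by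
  rw [← l2_opNorm_toEuclideanCLM]
  congr 1
  rw [weightedOp, adjoint_toEuclideanCLM_conjTranspose, adjoint_toEuclideanCLM_conjTranspose,
    map_add, ← Complex.coe_smul x (a * aᴴ), ← Complex.coe_smul (1 / x) (b * bᴴ), map_smul, map_smul,
    map_mul, map_mul, one_div]
  rfl

/-- Symmetry makes `a` the entrywise conjugate of `aᴴ`. -/
theorem toEuclideanCLM_conjVec {a : Matrix m m ℂ} (ha : a.IsSymm) (v : EuclideanSpace ℂ m) :
    Φ a (conjVec v) = conjVec (Φ aᴴ v) := by
  simp only [conjVec, toEuclideanCLM_toLp, ofLp_toEuclideanCLM, star_mulVec,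
    conjTranspose_conjTranspose, ← mulVec_transpose, ha.eq]

theorem weightedForm_conjVec {a b : Matrix m m ℂ} (ha : a.IsSymm) (hb : b.IsSymm) (x : ℝ)
    (v : EuclideanSpace ℂ m) :
    weightedForm (Φ a) (Φ b) x (conjVec v) = weightedForm (Φ aᴴ) (Φ bᴴ) x v := by
  simp only [weightedForm, toEuclideanCLM_conjVec, ha, hb, norm_conjVec]

open scoped Kronecker

theorem blockVec_one_kronecker {n : ℕ} (a : Matrix m m ℂ) (η : EuclideanSpace ℂ (Fin n × m))
    (i : Fin n) :
    blockVec (Φ ((1 : Matrix (Fin n) (Fin n) ℂ) ⊗ₖ a) η) i = Φ a (blockVec η i) := by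
  ext k
  simp [blockVec, ofLp_toEuclideanCLM, mulVec, dotProduct, Fintype.sum_prod_type, one_apply,
    ite_mul]

theorem weightedForm_one_kronecker {n : ℕ} (a b : Matrix m m ℂ) (x : ℝ)
    (η : EuclideanSpace ℂ (Fin n × m)) :
    weightedForm (Φ ((1 : Matrix (Fin n) (Fin n) ℂ) ⊗ₖ a)) (Φ ((1 : Matrix (Fin n) (Fin n) ℂ) ⊗ₖ b))
      x η = ∑ i, weightedForm (Φ a) (Φ b) x (blockVec η i) := by
  simp only [weightedForm, norm_sq_eq_sum_blockVec, blockVec_one_kronecker, Finset.mul_sum,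
    Finset.sum_add_distrib]

theorem weightedForm_one_kronecker_le {n : ℕ} {a b : Matrix m m ℂ} {x c : ℝ}
    (h : ∀ v, weightedForm (Φ a) (Φ b) x v ≤ c * ‖v‖ ^ 2) (η : EuclideanSpace ℂ (Fin n × m)) :
    weightedForm (Φ ((1 : Matrix (Fin n) (Fin n) ℂ) ⊗ₖ a)) (Φ ((1 : Matrix (Fin n) (Fin n) ℂ) ⊗ₖ b))
      x η ≤ c * ‖η‖ ^ 2 := by
  rw [weightedForm_one_kronecker, norm_sq_eq_sum_blockVec, Finset.mul_sum]
  exact Finset.sum_le_sum fun i _ => h _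

theorem amplification_jordanElementary (n : ℕ) (a b : Matrix m m ℂ)
    (X : Matrix (Fin n × m) (Fin n × m) ℂ) :
    amplification n (jordanElementary a b) X =
      ((1 : Matrix (Fin n) (Fin n) ℂ) ⊗ₖ a) * X * ((1 : Matrix (Fin n) (Fin n) ℂ) ⊗ₖ b) +
      ((1 : Matrix (Fin n) (Fin n) ℂ) ⊗ₖ b) * X * ((1 : Matrix (Fin n) (Fin n) ℂ) ⊗ₖ a) := by
  ext ⟨i, k⟩ ⟨j, l⟩
  simp [amplification, jordanElementary, mul_apply, Fintype.sum_prod_type, one_apply, ite_mul,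
    mul_ite, Finset.sum_ite_irrel]

theorem norm_amplification_jordanElementary_le {a b : Matrix m m ℂ} (ha : a.IsSymm)
    (hb : b.IsSymm) (n : ℕ) {x : ℝ} (hx : 0 < x) :
    ‖amplification n (jordanElementary a b)‖ ≤ ‖x • (a * aᴴ) + (1 / x) • (b * bᴴ)‖ := by
  refine opNorm_le_bound _ (norm_nonneg _) fun X => ?_
  rw [amplification_jordanElementary, ← norm_weightedOp_conjTranspose,
    ← l2_opNorm_toEuclideanCLM, ← l2_opNorm_toEuclideanCLM X, map_add, map_mul, map_mul, map_mul,
    map_mul, mul_assoc, mul_assoc]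
  have h' : ∀ v, weightedForm (Φ aᴴ) (Φ bᴴ) x v ≤ ‖weightedOp (Φ aᴴ) (Φ bᴴ) x‖ * ‖v‖ ^ 2 :=
    weightedForm_le _ _ x
  have h : ∀ v, weightedForm (Φ a) (Φ b) x v ≤ ‖weightedOp (Φ aᴴ) (Φ bᴴ) x‖ * ‖v‖ ^ 2 := fun v => by
    have := h' (conjVec v)
    rwa [← weightedForm_conjVec ha hb, conjVec_conjVec, norm_conjVec] at this
  refine norm_jordan_le_of_weightedForm_le _ _ _ hx (fun η hη => ?_) (fun ξ hξ => ?_)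
    (norm_nonneg _)
  · simpa [hη] using weightedForm_one_kronecker_le h η
  · rw [← toEuclideanCLM_conjTranspose, ← toEuclideanCLM_conjTranspose, conjTranspose_kronecker,
      conjTranspose_kronecker, conjTranspose_one]
    simpa [hξ] using weightedForm_one_kronecker_le h' ξ

theorem norm_one_kronecker (M : Matrix m m ℂ) :
    ‖(1 : Matrix (Fin 1) (Fin 1) ℂ) ⊗ₖ M‖ = ‖M‖ := by
  have key : ∀ η : EuclideanSpace ℂ (Fin 1 × m),
      ‖Φ ((1 : Matrix (Fin 1) (Fin 1) ℂ) ⊗ₖ M) η‖ = ‖Φ M (blockVec η 0)‖ ∧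
      ‖η‖ = ‖blockVec η 0‖ := fun η => by
    constructor <;> rw [← sq_eq_sq₀ (norm_nonneg _) (norm_nonneg _)]
    · rw [norm_sq_eq_sum_blockVec, Fin.sum_univ_one, blockVec_one_kronecker]
    · rw [norm_sq_eq_sum_blockVec, Fin.sum_univ_one]
  rw [← l2_opNorm_toEuclideanCLM, ← l2_opNorm_toEuclideanCLM M]
  refine le_antisymm (opNorm_le_bound _ (norm_nonneg _) fun η => ?_)
    (opNorm_le_bound _ (norm_nonneg _) fun v => ?_)
  · rw [(key η).1, (key η).2]
    exact le_opNorm _ _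
  · have hv : v = blockVec (WithLp.toLp 2 fun p : Fin 1 × m => v p.2) 0 := by
      ext k; simp [blockVec]
    rw [hv, ← (key _).1, ← (key _).2]
    exact le_opNorm _ _

theorem norm_jordanElementary_le_amplification_one (a b : Matrix m m ℂ) :
    ‖jordanElementary a b‖ ≤ ‖amplification 1 (jordanElementary a b)‖ := by
  refine opNorm_le_bound _ (norm_nonneg _) fun Y => ?_
  have h : amplification 1 (jordanElementary a b) ((1 : Matrix (Fin 1) (Fin 1) ℂ) ⊗ₖ Y) =
      (1 : Matrix (Fin 1) (Fin 1) ℂ) ⊗ₖ (jordanElementary a b Y) := by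
    rw [amplification_jordanElementary, ← mul_kronecker_mul, ← mul_kronecker_mul,
      ← mul_kronecker_mul, ← mul_kronecker_mul, one_mul, one_mul, ← kronecker_add]
    rfl
  rw [← norm_one_kronecker Y, ← norm_one_kronecker (jordanElementary a b Y), ← h]
  exact le_opNorm _ _

theorem jordanElementary_zero_left (b : Matrix m m ℂ) : jordanElementary 0 b = 0 := by
  ext1 X; simp [jordanElementary]

theorem jordanElementary_zero_right (a : Matrix m m ℂ) : jordanElementary a 0 = 0 := by
  ext1 X; simp [jordanElementary]

/-- For nonzero symmetric matrices the norm of the Jordan elementary operator dominates some value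
of `x ↦ ‖x a a* + x⁻¹ b b*‖`. -/
theorem exists_norm_le_norm_jordanElementary [Nonempty m] {a b : Matrix m m ℂ} (ha : a.IsSymm)
    (hb : b.IsSymm) (ha0 : a ≠ 0) (hb0 : b ≠ 0) :
    ∃ x : ℝ, 0 < x ∧ ‖x • (a * aᴴ) + (1 / x) • (b * bᴴ)‖ ≤ ‖jordanElementary a b‖ := by
  have hA : Φ aᴴ ≠ 0 := by simpa using ha0
  have hB : Φ bᴴ ≠ 0 := by simpa using hb0
  obtain ⟨x, hx, hmin⟩ := exists_min_norm_weightedOp _ _ hA hB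
  obtain ⟨ξ, hξ0, hξ, hbal⟩ := exists_balanced_top_vector _ _ hx hmin
  refine ⟨x, hx, ?_⟩
  rw [← norm_weightedOp_conjTranspose]
  have hxC : (x : ℂ) ≠ 0 := by exact_mod_cast hx.ne'
  -- Conjugation reverses the inner product, hence the swap of `aᴴ` and `bᴴ` in the targets; the
  -- scalars `x⁻¹`, `x` cancel in it and match the norms by balance.
  obtain ⟨U, hU1, hU2⟩ := exists_linearIsometry_of_gram_eq
    (u := conjVec (Φ aᴴ ξ)) (v := conjVec (Φ bᴴ ξ))
    (u' := ((x⁻¹ : ℝ) : ℂ) • Φ bᴴ ξ) (v' := (x : ℂ) • Φ aᴴ ξ)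
    (by rw [norm_conjVec, norm_smul, hbal, Complex.norm_real, Real.norm_of_nonneg (by positivity)]
        field_simp)
    (by rw [norm_conjVec, norm_smul, hbal, Complex.norm_real, Real.norm_of_nonneg hx.le])
    (by rw [inner_conjVec, inner_smul_left, inner_smul_right, Complex.conj_ofReal,
          Complex.ofReal_inv, inv_mul_cancel_left₀ hxC])
  set X : Matrix m m ℂ := (Matrix.toEuclideanCLM (n := m) (𝕜 := ℂ)).symm U.toContinuousLinearMap
    with hX
  have hΦX : Φ X = U.toContinuousLinearMap := by simp [hX]
  have hXn : ‖X‖ ≤ 1 := by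
    rw [← l2_opNorm_toEuclideanCLM, hΦX]; exact U.norm_toContinuousLinearMap_le
  have hT : Φ (jordanElementary a b X) (conjVec ξ) = weightedOp (Φ aᴴ) (Φ bᴴ) x ξ := by
    have e : jordanElementary a b X = a * X * b + b * X * a := rfl
    rw [e, map_add, map_mul, map_mul, map_mul, map_mul, hΦX]
    change Φ a (U (Φ b (conjVec ξ))) + Φ b (U (Φ a (conjVec ξ))) = _
    rw [toEuclideanCLM_conjVec ha, toEuclideanCLM_conjVec hb, hU1, hU2, map_smul, map_smul,
      weightedOp, adjoint_toEuclideanCLM_conjTranspose, adjoint_toEuclideanCLM_conjTranspose,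
      Complex.coe_smul, Complex.coe_smul]
    rfl
  have h1 : ‖Φ (jordanElementary a b X) (conjVec ξ)‖ ≤ ‖jordanElementary a b X‖ * ‖ξ‖ := by
    rw [← l2_opNorm_toEuclideanCLM, ← norm_conjVec ξ]
    exact le_opNorm _ _
  rw [hT, hξ, norm_smul, Complex.norm_real, norm_norm] at h1
  refine (le_of_mul_le_mul_right h1 (norm_pos_iff.2 hξ0)).trans ?_
  exact (le_opNorm _ X).trans (mul_le_of_le_one_right (norm_nonneg _) hXn)

theorem bddBelow_range_norm_weighted (a b : Matrix m m ℂ) :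
    BddBelow (Set.range fun x : Set.Ioi (0 : ℝ) =>
      ‖(x : ℝ) • (a * aᴴ) + (1 / (x : ℝ)) • (b * bᴴ)‖) :=
  ⟨0, by rintro _ ⟨x, rfl⟩; exact norm_nonneg _⟩

theorem iInf_norm_le_norm_jordanElementary [Nonempty m] {a b : Matrix m m ℂ} (ha : a.IsSymm)
    (hb : b.IsSymm) :
    ⨅ x : Set.Ioi (0 : ℝ), ‖(x : ℝ) • (a * aᴴ) + (1 / (x : ℝ)) • (b * bᴴ)‖ ≤
      ‖jordanElementary a b‖ := by
  have hle : ∀ x : ℝ, 0 < x →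
      ⨅ x : Set.Ioi (0 : ℝ), ‖(x : ℝ) • (a * aᴴ) + (1 / (x : ℝ)) • (b * bᴴ)‖ ≤
        ‖x • (a * aᴴ) + (1 / x) • (b * bᴴ)‖ :=
    fun x hx => ciInf_le (bddBelow_range_norm_weighted a b) ⟨x, hx⟩
  by_cases ha0 : a = 0
  · subst ha0
    rw [jordanElementary_zero_left, norm_zero]
    -- The infimum need not be attained here: a large weight makes the `b` term at most `ε`.
    refine le_of_forall_pos_le_add fun ε hε => (hle ((‖b * bᴴ‖ + 1) / ε) (by positivity)).trans ?_
    rw [zero_mul, smul_zero, zero_add, zero_add, norm_smul, one_div_div,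
      Real.norm_of_nonneg (by positivity), div_mul_eq_mul_div, div_le_iff₀ (by positivity)]
    nlinarith
  by_cases hb0 : b = 0
  · subst hb0
    rw [jordanElementary_zero_right, norm_zero]
    refine le_of_forall_pos_le_add fun ε hε => (hle (ε / (‖a * aᴴ‖ + 1)) (by positivity)).trans ?_
    rw [zero_mul, smul_zero, add_zero, zero_add, norm_smul,
      Real.norm_of_nonneg (by positivity), div_mul_eq_mul_div, div_le_iff₀ (by positivity)]
    nlinarith
  obtain ⟨x, hx, h⟩ := exists_norm_le_norm_jordanElementary ha hb ha0 hb0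
  exact (hle x hx).trans h

end MatrixPart

theorem proposition3p5 (a b : Matrix (Fin 2) (Fin 2) ℂ) (ha : a.IsSymm) (hb : b.IsSymm) :
    cbNorm (jordanElementary a b) = ENNReal.ofReal ‖jordanElementary a b‖ ∧
      ‖jordanElementary a b‖ =
        ⨅ x : Set.Ioi (0 : ℝ), ‖(x : ℝ) • (a * aᴴ) + (1 / (x : ℝ)) • (b * bᴴ)‖ := by
  have : Nonempty (Set.Ioi (0 : ℝ)) := ⟨⟨1, Set.mem_Ioi.2 one_pos⟩⟩
  have hlow := iInf_norm_le_norm_jordanElementary ha hb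
  have hupp : ∀ n, ‖amplification n (jordanElementary a b)‖ ≤
      ⨅ x : Set.Ioi (0 : ℝ), ‖(x : ℝ) • (a * aᴴ) + (1 / (x : ℝ)) • (b * bᴴ)‖ :=
    fun n => le_ciInf fun x => norm_amplification_jordanElementary_le ha hb n x.2
  have hone := norm_jordanElementary_le_amplification_one a b
  -- The cycle `‖T‖ ≤ ‖T₁‖ ≤ inf ≤ ‖T‖`, with `‖Tₙ‖ ≤ inf` for all `n`, forces equality throughout.
  refine ⟨le_antisymm (iSup_le fun n => ENNReal.ofReal_le_ofReal ((hupp n).trans hlow)) ?_,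
    le_antisymm (hone.trans (hupp 1)) hlow⟩
  exact (ENNReal.ofReal_le_ofReal hone).trans
    (le_iSup (fun n => ENNReal.ofReal ‖amplification n (jordanElementary a b)‖) 1)
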